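/- **Conventions.** Let $\mathbb K$ be an arbitrary field. An associative unital $\mathbb K$-algebra $A$ is *separable* if its multiplication $A\otimes_{\mathbb K}A\to A$ has a section that is a morphism of $(A,A)$-bimodules. A *fusion category* over $\mathbb K$ is an abelian $\mathbb K$-linear rigid monoidal category $\mathcal C$ whose tensor product is $\mathbb K$-linear in both arguments, whose unit object $\mathbf 1$ is simple, and which is equivalent, as a $\mathbb K$-linear category, to the category of finite-dimensional left modules over some finite-dimensional separable $\mathbb K$-algebra. Write $\mathbb E=\mathrm{End}(\mathbf 1)$, a field. For an object $X$ with left unit isomorphism $\ell_X:\mathbf 1\otimes X\to X$, the *left embedding* is the ring homomorphism $\lambda_X:\mathbb E\to\mathrm{End}(X)$, $\lambda_X(e)=\ell_X\circ(e\otimes\mathrm{id}_X)\circ\ell_X^{-1}$; via $\lambda_X$ the ring $\mathrm{End}(X)$ is an $\mathbb E$-vector space, with $e\cdot f=\lambda_X(e)\circ f$, and $\dim_{\mathbb E}\mathrm{End}(X)$ is its dimension. The *fusion semiring* $\mathbb N\mathcal O(\mathcal C)$ is the semiring of isomorphism classes of objects of $\mathcal C$, with $[X]+[Y]=[X\oplus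 Y]$ and $[X]\cdot[Y]=[X\otimes Y]$; as a commutative monoid it is free on the set $\mathcal O(\mathcal C)$ of isomorphism classes of simple objects. For $a\in\mathbb N\mathcal O(\mathcal C)$ let $L_a$ be left multiplication by $a$ on $\mathbb R\otimes_{\mathbb N}\mathbb N\mathcal O(\mathcal C)$, and let $\mathrm{FPdim}(a)$ be the largest non-negative real eigenvalue of $L_a$; put $\mathrm{FPdim}(X)=\mathrm{FPdim}([X])$. A *regular element* is a nonzero $\mathcal R\in\mathbb R\otimes_{\mathbb N}\mathbb N\mathcal O(\mathcal C)$ such that $x\mathcal R=\mathrm{FPdim}(x)\mathcal R$ for all $x\in\mathbb N\mathcal O(\mathcal C)$. **Theorem.** Let $\mathcal C$ be a fusion category over $\mathbb K$. Then $\mathcal O(\mathcal C)$ is finite, for every $a\in\mathbb N\mathcal O(\mathcal C)$ the operator $L_a$ has a largest non-negative real eigenvalue (so $\mathrm{FPdim}(a)$ is well defined), and, with $$\mathcal R_0\;=\;\sum_{[X]\in\mathcal O(\mathcal C)}\frac{\mathrm{FPdim}(X)}{\dim_{\mathbb E}\mathrm{End}(X)}\cdot[X],$$ the regular elements are exactly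 the nonzero real multiples of $\mathcal R_0$, and the regular elements all of whose coefficients in the basis $\mathcal O(\mathcal C)$ are positive are exactly the positive real multiples of $\mathcal R_0$. That is, up to a positive scalar factor, the regular element of $\mathcal C$, normalized to have positive coefficients, is $\mathcal R_0$. -/

import Mathlib

open CategoryTheory CategoryTheory.Limits CategoryTheory.MonoidalCategory
open scoped TensorProduct

universe w v u

/-- A `K`-algebra `A` is separable if the multiplication `A ⊗ A → A` admits a section `θ` which is
a morphism of `(A, A)`-bimodules.  In the algebra `A ⊗ A`, the bimodule action
`a · (x ⊗ y) · b = ax ⊗ yb` is multiplication by `a ⊗ 1` on the left and by `1 ⊗ b` on the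
right. -/
def IsSeparableAlgebra (K A : Type*) [Field K] [Ring A] [Algebra K A] : Prop :=
  ∃ θ : A →ₗ[K] A ⊗[K] A,
    (∀ a b : A, θ (a * b) = (a ⊗ₜ[K] (1 : A)) * θ b) ∧
    (∀ a b : A, θ (a * b) = θ a * ((1 : A) ⊗ₜ[K] b)) ∧
    ∀ a : A, LinearMap.mul' K A (θ a) = a

section

attribute [local instance] ModuleCat.moduleOfAlgebraModule ModuleCat.linearOverField

/-- A `K`-linear category is separable over `K` if it is equivalent, by a `K`-linear functor, to
the category of finite dimensional left modules over a finite dimensional separable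
`K`-algebra. -/
def IsSeparableCategory (K : Type w) [Field K] (C : Type u) [Category.{v} C] [Preadditive C]
    [Linear K C] : Prop :=
  ∃ (A : Type w) (_ : Ring A) (_ : Algebra K A) (F : C ⥤ FGModuleCat.{w} A),
    Module.Finite K A ∧ IsSeparableAlgebra K A ∧
      F.IsEquivalence ∧ F.Additive ∧ F.Linear K

end

/-- A fusion category over `K`: a rigid monoidal abelian `K`-linear category, with tensor product
`K`-linear in both arguments, which is separable over `K` and whose unit object is simple. -/
class IsFusionCategory (K : Type w) [Field K] (C : Type u) [Category.{v} C] [Abelian C]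
    [Linear K C] [MonoidalCategory C] [MonoidalPreadditive C] [MonoidalLinear K C]
    [RigidCategory C] : Prop where
  separable : IsSeparableCategory K C
  simple_unit : Simple (𝟙_ C)

/-- The left embedding `λ_X : End 𝟙 → End X`, sending `e` to
`X ≅ 𝟙 ⊗ X ⟶ 𝟙 ⊗ X ≅ X`, with `e ⊗ id_X` in the middle. -/
def leftEmbedding {C : Type u} [Category.{v} C] [Preadditive C] [MonoidalCategory C]
    [MonoidalPreadditive C] (X : C) : End (𝟙_ C) →+* End X where
  toFun e := (λ_ X).inv ≫ ((e : 𝟙_ C ⟶ 𝟙_ C) ▷ X) ≫ (λ_ X).hom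
  map_one' := by
    change (λ_ X).inv ≫ (𝟙 (𝟙_ C) ▷ X) ≫ (λ_ X).hom = 𝟙 X
    simp
  map_mul' e f := by
    change (λ_ X).inv ≫ ((CategoryStruct.comp (X := 𝟙_ C) (Y := 𝟙_ C) f e) ▷ X) ≫ (λ_ X).hom
      = ((λ_ X).inv ≫ (f ▷ X) ≫ (λ_ X).hom) ≫ ((λ_ X).inv ≫ (e ▷ X) ≫ (λ_ X).hom)
    simp
  map_zero' := by
    change (λ_ X).inv ≫ ((0 : 𝟙_ C ⟶ 𝟙_ C) ▷ X) ≫ (λ_ X).hom = (0 : X ⟶ X)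
    simp
  map_add' e f := by
    change ((λ_ X).inv ≫ ((e + f : 𝟙_ C ⟶ 𝟙_ C) ▷ X) ≫ (λ_ X).hom : X ⟶ X)
      = (λ_ X).inv ≫ (e ▷ X) ≫ (λ_ X).hom + (λ_ X).inv ≫ (f ▷ X) ≫ (λ_ X).hom
    rw [MonoidalPreadditive.add_whiskerRight, Preadditive.add_comp, Preadditive.comp_add]

/-- `dim_E End X`, where `E = End 𝟙` acts on `End X` through the left embedding. -/
noncomputable def endDim {C : Type u} [Category.{v} C] [Preadditive C] [MonoidalCategory C]
    [MonoidalPreadditive C] (X : C) : ℕ :=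
  letI : Module (End (𝟙_ C)) (End X) := Module.compHom (End X) (leftEmbedding X)
  Module.finrank (End (𝟙_ C)) (End X)

theorem endDim_congr {C : Type u} [Category.{v} C] [Preadditive C] [MonoidalCategory C]
    [MonoidalPreadditive C] {X Y : C} (i : X ≅ Y) : endDim X = endDim Y := by
  let _ : Module (End (𝟙_ C)) (End X) := Module.compHom (End X) (leftEmbedding X)
  let _ : Module (End (𝟙_ C)) (End Y) := Module.compHom (End Y) (leftEmbedding Y)
  have key : ∀ e : 𝟙_ C ⟶ 𝟙_ C, (λ_ Y).inv ≫ (e ▷ Y) ≫ (λ_ Y).hom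
      = i.inv ≫ ((λ_ X).inv ≫ (e ▷ X) ≫ (λ_ X).hom) ≫ i.hom := by
    intro e
    simp only [Category.assoc]
    rw [← leftUnitor_naturality, ← whisker_exchange_assoc, ← leftUnitor_inv_naturality_assoc,
      Iso.inv_hom_id_assoc]
  let φ : End X ≃ₗ[End (𝟙_ C)] End Y :=
    { toFun := fun f => i.inv ≫ f ≫ i.hom
      invFun := fun f => i.hom ≫ f ≫ i.inv
      map_add' := fun f g => by
        change (i.inv ≫ ((f + g : X ⟶ X) ≫ i.hom) : Y ⟶ Y)
          = i.inv ≫ f ≫ i.hom + i.inv ≫ g ≫ i.hom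
        rw [Preadditive.add_comp, Preadditive.comp_add]
      map_smul' := fun e f => by
        change i.inv ≫ (CategoryStruct.comp (X := X) (Y := X) f
            ((λ_ X).inv ≫ (e ▷ X) ≫ (λ_ X).hom)) ≫ i.hom
          = (i.inv ≫ f ≫ i.hom) ≫ ((λ_ Y).inv ≫ (e ▷ Y) ≫ (λ_ Y).hom)
        rw [key]
        simp
      left_inv := fun f => by simp
      right_inv := fun f => by simp }
  exact LinearEquiv.finrank_eq φ

/-- The underlying set of the fusion semiring: isomorphism classes of objects.  When every object
is a finite direct sum of simple objects, this is, with `[X] + [Y] = [X ⊕ Y]`, the free commutative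
monoid on the isomorphism classes of simple objects. -/
def FusionSemiring (C : Type u) [Category.{v} C] : Type u :=
  Quotient (isIsomorphicSetoid C)

namespace FusionSemiring

section

variable {C : Type u} [Category.{v} C]

/-- The class `[X]` of an object. -/
def mk (X : C) : FusionSemiring C := Quotient.mk (isIsomorphicSetoid C) X

theorem mk_eq {X Y : C} (i : X ≅ Y) : mk X = mk Y :=
  Quotient.sound (s := isIsomorphicSetoid C) ⟨i⟩

theorem ind {p : FusionSemiring C → Prop} (h : ∀ X : C, p (mk X)) (x : FusionSemiring C) : p x :=
  Quotient.ind (s := isIsomorphicSetoid C) h x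

end

section

variable {C : Type u} [Category.{v} C] [Abelian C]

/-- `0` is the class of the zero object. -/
noncomputable instance : Zero (FusionSemiring C) where
  zero := mk (HasZeroObject.zero' C).zero

/-- `[X] + [Y] = [X ⊕ Y]`. -/
noncomputable instance : Add (FusionSemiring C) where
  add := Quotient.map₂ (fun X Y : C => X ⊞ Y)
    (fun _ _ ⟨i⟩ _ _ ⟨j⟩ => ⟨biprod.mapIso i j⟩)

theorem mk_eq_zero {X : C} (h : IsZero X) : mk X = 0 := mk_eq (h.iso (isZero_zero C))

end

section

variable {C : Type u} [Category.{v} C] [MonoidalCategory C]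

/-- `1` is the class of the unit object. -/
instance : One (FusionSemiring C) where
  one := mk (𝟙_ C)

/-- `[X] · [Y] = [X ⊗ Y]`. -/
instance : Mul (FusionSemiring C) where
  mul := Quotient.map₂ (fun X Y : C => X ⊗ Y)
    (fun _ _ ⟨i⟩ _ _ ⟨j⟩ => ⟨i ⊗ᵢ j⟩)

end

section

variable {C : Type u} [Category.{v} C] [Abelian C] [MonoidalCategory C] [MonoidalPreadditive C]

noncomputable instance : Semiring (FusionSemiring C) where
  add_assoc x y z := by
    induction x using ind with | h X
    induction y using ind with | h Y
    induction z using ind with | h Z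
    exact mk_eq (biprod.associator X Y Z)
  zero_add x := by
    induction x using ind with | h X
    exact (mk_eq (isoZeroBiprod (isZero_zero C))).symm
  add_zero x := by
    induction x using ind with | h X
    exact (mk_eq (isoBiprodZero (isZero_zero C))).symm
  add_comm x y := by
    induction x using ind with | h X
    induction y using ind with | h Y
    exact mk_eq (biprod.braiding X Y)
  nsmul := nsmulRec
  mul_assoc x y z := by
    induction x using ind with | h X
    induction y using ind with | h Y
    induction z using ind with | h Z
    exact mk_eq (α_ X Y Z)
  one_mul x := by
    induction x using ind with | h X
    exact mk_eq (λ_ X)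
  mul_one x := by
    induction x using ind with | h X
    exact mk_eq (ρ_ X)
  zero_mul x := by
    induction x using ind with | h X
    exact mk_eq_zero ((tensorRight X).map_isZero (isZero_zero C))
  mul_zero x := by
    induction x using ind with | h X
    exact mk_eq_zero ((tensorLeft X).map_isZero (isZero_zero C))
  left_distrib x y z := by
    induction x using ind with | h X
    induction y using ind with | h Y
    induction z using ind with | h Z
    have := preservesBinaryBiproducts_of_preservesBiproducts (tensorLeft X)
    exact mk_eq ((tensorLeft X).mapBiprod Y Z)
  right_distrib x y z := by
    induction x using ind with | h X
    induction y using ind with | h Y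
    induction z using ind with | h Z
    have := preservesBinaryBiproducts_of_preservesBiproducts (tensorRight Z)
    exact mk_eq ((tensorRight Z).mapBiprod X Y)

variable (C) in
/-- The set `O(C)` of isomorphism classes of simple objects. -/
def simples : Set (FusionSemiring C) := {x | ∃ X : C, Simple X ∧ mk X = x}

/-- `dim_E End X` as a function of the class `[X]`. -/
noncomputable def dimEnd : FusionSemiring C → ℕ :=
  Quotient.lift (fun X : C => endDim X) (fun _ _ ⟨i⟩ => endDim_congr i)

/-- The operator `L_a` of left multiplication by `a` on `ℝ ⊗ S(C)`; its matrix in the basis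
`O(C)` is the matrix of left multiplication by `a`. -/
noncomputable def leftMul (a : FusionSemiring C) :
    Module.End ℝ (ℝ ⊗[ℕ] FusionSemiring C) :=
  LinearMap.mulLeft ℝ ((1 : ℝ) ⊗ₜ[ℕ] a)

/-- The non-negative real eigenvalues of `L_a`. -/
def nonnegEigenvalues (a : FusionSemiring C) : Set ℝ :=
  {t | 0 ≤ t ∧ (leftMul a).HasEigenvalue t}

/-- `FPdim a`, the largest non-negative eigenvalue of `L_a`. -/
noncomputable def FPdim (a : FusionSemiring C) : ℝ := sSup (nonnegEigenvalues a)

/-- `R ∈ ℝ ⊗ S(C)` is a regular element if it is nonzero and `x R = FPdim(x) R` for all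
`x ∈ S(C)`. -/
def IsRegularElement (R : ℝ ⊗[ℕ] FusionSemiring C) : Prop :=
  R ≠ 0 ∧ ∀ x : FusionSemiring C, ((1 : ℝ) ⊗ₜ[ℕ] x) * R = FPdim x • R

/-- `R ∈ ℝ ⊗ S(C)` has positive coefficients if it is a sum of the simple elements with positive
real coefficients (when there are finitely many of them). -/
def HasPositiveCoefficients (R : ℝ ⊗[ℕ] FusionSemiring C) : Prop :=
  ∃ c : FusionSemiring C → ℝ, (∀ x ∈ simples C, 0 < c x) ∧
    R = ∑ᶠ x ∈ simples C, c x ⊗ₜ[ℕ] x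

end

end FusionSemiring

/-!
Let `S` be the fusion semiring.  Separability of the algebra makes every monomorphism of `C` split,
by averaging with the separability idempotent, so every object is a finite direct sum of simple
objects, all of which occur in the generator corresponding to the regular module.  The pairing
`⟨[X], [Y]⟩ = dim_K Hom(X, Y)` is biadditive, and by Schur's lemma the simple classes are orthogonal
for it, with `⟨[X], [X]⟩ = D_X := dim_K End X > 0`.  Hence they form a basis of `S` over `ℕ`.  By
rigidity, left multiplication by `[X]` is adjoint to left multiplication by the class of a dual of
`X`, and likewise on the right.

The rest is linear algebra on a semiring `S` with such a form
(`Module.Basis.exists_regular_element`).  If `x'` is the adjoint of `x`, then `1` occurs in `x x'`;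
therefore left and right multiplication by the sum `s` of the basis have positive matrices.  The
Perron vector `v` of right multiplication by `s` is an eigenvector of all left multiplications, as
these commute with right multiplication by `s` and its eigenspace is a line.  The eigenvalues `f x`
on `v` form a character of `S`, and since `v` is positive, `f x` is the spectral radius of left
multiplication by `x`, that is, `FPdim x`.  For the vector `R` with coefficients `f(X) / D_X`, the
adjunction gives `x R = f(x') R`; as `R` is positive as well, `f(x')` is again the spectral radius of
left multiplication by `x`, so `x R = f(x) R`.  Uniqueness holds because the eigenspace of left
multiplication by `s` is a line.

Finally, `D_X = dim_K End 𝟙 · dim_E End X` by the tower law (`FusionSemiring.homForm_self_eq`), so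
the dimensions over `E = End 𝟙` can be replaced by those over `K`, which do not depend on the
choice between the left and the right embedding of `E`.
-/

/-! ### Perron's theorem for positive matrices -/

section Perron

open Matrix

variable {I : Type*} [Fintype I]

theorem Matrix.mulVec_pos_of_pos {A : Matrix I I ℝ} (hA : ∀ i j, 0 < A i j) {v : I → ℝ}
    (hv : ∀ i, 0 ≤ v i) (hv0 : v ≠ 0) (i : I) : 0 < (A *ᵥ v) i := by
  obtain ⟨j, hj⟩ := Function.ne_iff.1 hv0
  exact Finset.sum_pos' (fun k _ => mul_nonneg (hA i k).le (hv k))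
    ⟨j, Finset.mem_univ j, mul_pos (hA i j) (lt_of_le_of_ne (hv j) (Ne.symm hj))⟩

theorem exists_pos_forall_mul_le {u w : I → ℝ} (hu : ∀ i, 0 < u i) (hw : ∀ i, 0 < w i) :
    ∃ ε > 0, ∀ i, ε * w i ≤ u i := by
  rcases isEmpty_or_nonempty I with h | h
  · exact ⟨1, one_pos, fun i => isEmptyElim i⟩
  · obtain ⟨i, hi⟩ := Finite.exists_min (fun i => u i / w i)
    exact ⟨u i / w i, div_pos (hu i) (hw i), fun j => (le_div_iff₀ (hw j)).1 (hi j)⟩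

/-- The existence part of Perron's theorem, by the method of Collatz and Wielandt: `t` is the
largest number such that `t v ≤ A v` for some nonzero vector `v ≥ 0`. -/
theorem Matrix.exists_pos_eigenvector [Nonempty I] {A : Matrix I I ℝ} (hA : ∀ i j, 0 < A i j) :
    ∃ (t : ℝ) (v : I → ℝ), (∀ i, 0 < v i) ∧ A *ᵥ v = t • v := by
  classical
  set M : ℝ := ∑ i, ∑ j, A i j with hM
  let S : Set ((I → ℝ) × ℝ) :=
    (stdSimplex ℝ I ×ˢ Set.Icc 0 M) ∩ {p | ∀ i, p.2 * p.1 i ≤ (A *ᵥ p.1) i}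
  have hS : IsCompact S := by
    refine ((isCompact_stdSimplex ℝ I).prod isCompact_Icc).inter_right ?_
    simp only [Set.ofPred_forall]
    refine isClosed_iInter fun i => isClosed_le (by fun_prop) ?_
    simp only [Matrix.mulVec, dotProduct]
    fun_prop
  -- The upper bound `M` in the definition of `S` is automatic.
  have hbound : ∀ v ∈ stdSimplex ℝ I, ∀ t : ℝ, (∀ i, t * v i ≤ (A *ᵥ v) i) → t ≤ M := by
    intro v hv t ht
    calc t = ∑ i, t * v i := by rw [← Finset.mul_sum, hv.2, mul_one]
      _ ≤ ∑ i, (A *ᵥ v) i := Finset.sum_le_sum fun i _ => ht i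
      _ ≤ M := by
        refine Finset.sum_le_sum fun i _ => Finset.sum_le_sum fun j _ => ?_
        have h1 : v j ≤ 1 := hv.2 ▸ Finset.single_le_sum (fun k _ => hv.1 k) (Finset.mem_univ j)
        exact mul_le_of_le_one_right (hA i j).le h1
  have hne : S.Nonempty := by
    obtain ⟨i⟩ := ‹Nonempty I›
    refine ⟨(Pi.single i 1, 0), ⟨single_mem_stdSimplex ℝ i, le_rfl, ?_⟩, fun k => ?_⟩
    · exact Finset.sum_nonneg fun i _ => Finset.sum_nonneg fun j _ => (hA i j).le
    · simpa using (hA k i).le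
  obtain ⟨⟨v, t⟩, ⟨⟨hv, ht0, htM⟩, hvt⟩, hmax⟩ := hS.exists_isMaxOn hne continuous_snd.continuousOn
  have hv0 : v ≠ 0 := by
    rintro rfl
    simpa using hv.2
  have hw := Matrix.mulVec_pos_of_pos hA hv.1 hv0
  have key : A *ᵥ v = t • v := by
    by_contra hne
    -- Otherwise `A v` in place of `v` allows a larger `t`.
    set w := A *ᵥ v with hwdef
    have hu : ∀ i, 0 < (A *ᵥ (w - t • v)) i :=
      Matrix.mulVec_pos_of_pos hA (fun i => by simpa using hvt i) (sub_ne_zero.2 hne)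
    obtain ⟨ε, hε, hεw⟩ := exists_pos_forall_mul_le hu hw
    set s := ∑ i, w i with hs
    have hspos : 0 < s := Finset.sum_pos (fun i _ => hw i) Finset.univ_nonempty
    have hmem : s⁻¹ • w ∈ stdSimplex ℝ I := by
      refine ⟨fun i => mul_nonneg (inv_nonneg.2 hspos.le) (hw i).le, ?_⟩
      simp only [Pi.smul_apply, smul_eq_mul]
      rw [← Finset.mul_sum, inv_mul_cancel₀ hspos.ne']
    have hineq : ∀ i, (t + ε) * (s⁻¹ • w) i ≤ (A *ᵥ (s⁻¹ • w)) i := by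
      intro i
      have h1 := hεw i
      rw [Matrix.mulVec_sub, Matrix.mulVec_smul, ← hwdef] at h1
      simp only [Pi.sub_apply, Pi.smul_apply, smul_eq_mul] at h1
      rw [Matrix.mulVec_smul]
      simp only [Pi.smul_apply, smul_eq_mul]
      rw [mul_left_comm]
      exact mul_le_mul_of_nonneg_left (by linarith) (inv_nonneg.2 hspos.le)
    have := hmax (show (s⁻¹ • w, t + ε) ∈ S from
      ⟨⟨hmem, by positivity, hbound _ hmem _ hineq⟩, hineq⟩)
    simp only [Set.mem_ofPred_eq] at this
    linarith
  refine ⟨t, v, fun i => lt_of_le_of_ne (hv.1 i) fun h => ?_, key⟩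
  have := hw i
  rw [key, Pi.smul_apply, ← h, smul_zero] at this
  exact lt_irrefl _ this

/-- A positive eigenvector of a positive matrix spans its eigenspace. -/
theorem Matrix.eq_smul_of_pos_eigenvector [Nonempty I] {A : Matrix I I ℝ}
    (hA : ∀ i j, 0 < A i j) {t : ℝ} {v w : I → ℝ} (hv : ∀ i, 0 < v i) (hAv : A *ᵥ v = t • v)
    (hAw : A *ᵥ w = t • w) : ∃ c : ℝ, w = c • v := by
  obtain ⟨i, hi⟩ := Finite.exists_min (fun i => w i / v i)
  -- The choice of `c` makes `w - c v` nonnegative, with a zero coefficient.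
  set c := w i / v i with hc
  refine ⟨c, sub_eq_zero.1 ?_⟩
  by_contra hne
  have hnn : ∀ j, 0 ≤ (w - c • v) j := fun j => by
    have := (le_div_iff₀ (hv j)).1 (hi j)
    simpa using this
  have h1 := Matrix.mulVec_pos_of_pos hA hnn hne i
  have h2 : (w - c • v) i = 0 := by
    simp [hc, div_mul_cancel₀ _ (hv i).ne']
  rw [Matrix.mulVec_sub, Matrix.mulVec_smul, hAv, hAw, smul_comm c t v, ← smul_sub,
    Pi.smul_apply, h2, smul_zero] at h1
  exact lt_irrefl _ h1

/-- If a nonnegative matrix has a positive eigenvector, then the eigenvalue of this vector is the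
spectral radius. -/
theorem Matrix.abs_eigenvalue_le {A : Matrix I I ℝ} (hA : ∀ i j, 0 ≤ A i j) {t s : ℝ}
    {v w : I → ℝ} (hv : ∀ i, 0 < v i) (hAv : A *ᵥ v = t • v) (hw : w ≠ 0)
    (hAw : A *ᵥ w = s • w) : |s| ≤ t := by
  obtain ⟨j, hj⟩ := Function.ne_iff.1 hw
  have : Nonempty I := ⟨j⟩
  obtain ⟨i, hi⟩ := Finite.exists_max (fun i => |w i| / v i)
  set c := |w i| / v i with hc
  have hwc : ∀ k, |w k| ≤ c * v k := fun k => (div_le_iff₀ (hv k)).1 (hi k)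
  have hwi : |w i| = c * v i := (div_mul_cancel₀ _ (hv i).ne').symm
  have hcpos : 0 < c := lt_of_lt_of_le (div_pos (abs_pos.2 hj) (hv j)) (hi j)
  have h1 : |s| * |w i| ≤ t * |w i| := by
    calc |s| * |w i| = |(A *ᵥ w) i| := by rw [hAw, Pi.smul_apply, smul_eq_mul, abs_mul]
      _ ≤ ∑ k, |A i k * w k| := Finset.abs_sum_le_sum_abs _ _
      _ ≤ ∑ k, c * (A i k * v k) := Finset.sum_le_sum fun k _ => by
        rw [abs_mul, abs_of_nonneg (hA i k), mul_left_comm]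
        exact mul_le_mul_of_nonneg_left (hwc k) (hA i k)
      _ = c * (A *ᵥ v) i := by rw [← Finset.mul_sum]; rfl
      _ = t * |w i| := by rw [hAv, Pi.smul_apply, smul_eq_mul, hwi]; ring
  exact le_of_mul_le_mul_right h1 (hwi ▸ mul_pos hcpos (hv i))

end Perron

/-! ### Semirings with a finite basis over the natural numbers -/

section BasedSemiring

open Matrix Module

variable {S : Type*} [Semiring S] {I : Type*} (b : Basis I ℕ S)

/-- The coefficients of an element of a semiring with a basis over `ℕ`, as real numbers. -/
noncomputable def Module.Basis.realCoords (x : S) : I → ℝ := fun i => (b.repr x i : ℝ)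

/-- The real matrix of left multiplication by `x`. -/
noncomputable def Module.Basis.leftMatrix (x : S) : Matrix I I ℝ :=
  Matrix.of fun i j => b.realCoords (x * b j) i

/-- The real matrix of right multiplication by `x`. -/
noncomputable def Module.Basis.rightMatrix (x : S) : Matrix I I ℝ :=
  Matrix.of fun i j => b.realCoords (b j * x) i

variable {b}

theorem Module.Basis.realCoords_nonneg (x : S) (i : I) : 0 ≤ b.realCoords x i := Nat.cast_nonneg _

theorem Module.Basis.realCoords_self [DecidableEq I] (i : I) :
    b.realCoords (b i) = Pi.single i 1 := by
  ext j
  simp [Module.Basis.realCoords, Finsupp.single_apply, Pi.single_apply, eq_comm]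

theorem Module.Basis.leftMatrix_add (x y : S) :
    b.leftMatrix (x + y) = b.leftMatrix x + b.leftMatrix y := by
  ext i j
  simp [Module.Basis.leftMatrix, Module.Basis.realCoords, add_mul]

variable [Fintype I]

theorem Module.Basis.addMonoidHom_apply {N : Type*} [AddCommMonoid N] (g : S →+ N) (x : S) :
    g x = ∑ j, b.repr x j • g (b j) := by
  conv_lhs => rw [← b.sum_repr x]
  rw [map_sum]
  exact Finset.sum_congr rfl fun j _ => map_nsmul g _ _

theorem Module.Basis.realCoords_map (g : S →+ S) (x : S) (i : I) :
    b.realCoords (g x) i = ∑ j, b.realCoords (g (b j)) i * b.realCoords x j := by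
  simp [Module.Basis.realCoords, mul_comm, b.addMonoidHom_apply g x, -nsmul_eq_mul]

theorem Module.Basis.leftMatrix_mulVec (x y : S) :
    b.leftMatrix x *ᵥ b.realCoords y = b.realCoords (x * y) := by
  ext i
  exact (b.realCoords_map (AddMonoidHom.mulLeft x) y i).symm

theorem Module.Basis.rightMatrix_mulVec (x y : S) :
    b.rightMatrix x *ᵥ b.realCoords y = b.realCoords (y * x) := by
  ext i
  exact (b.realCoords_map (AddMonoidHom.mulRight x) y i).symm

theorem Module.Basis.leftMatrix_mul_rightMatrix (x y : S) :
    b.leftMatrix x * b.rightMatrix y = b.rightMatrix y * b.leftMatrix x := by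
  classical
  refine Matrix.ext_of_mulVec_single fun i => ?_
  rw [← b.realCoords_self, ← Matrix.mulVec_mulVec, ← Matrix.mulVec_mulVec, b.rightMatrix_mulVec,
    b.leftMatrix_mulVec, b.leftMatrix_mulVec, b.rightMatrix_mulVec, mul_assoc]

theorem Module.Basis.leftMatrix_mul (x y : S) :
    b.leftMatrix (x * y) = b.leftMatrix x * b.leftMatrix y := by
  classical
  refine Matrix.ext_of_mulVec_single fun i => ?_
  rw [← b.realCoords_self, ← Matrix.mulVec_mulVec, b.leftMatrix_mulVec,
    b.leftMatrix_mulVec, b.leftMatrix_mulVec, mul_assoc]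

theorem Module.Basis.baseChange_equivFun_mul (x : S) (R : ℝ ⊗[ℕ] S) :
    (b.baseChange ℝ).equivFun (((1 : ℝ) ⊗ₜ[ℕ] x) * R) =
      b.leftMatrix x *ᵥ (b.baseChange ℝ).equivFun R := by
  induction R with
  | zero => simp
  | add y z hy hz => rw [mul_add, map_add, map_add, hy, hz, Matrix.mulVec_add]
  | tmul r y =>
    have : ∀ (z : S), (b.baseChange ℝ).equivFun (r ⊗ₜ[ℕ] z) = r • b.realCoords z := fun z => by
      ext i
      simp [Module.Basis.baseChange_repr_tmul, Module.Basis.realCoords, mul_comm]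
    rw [Algebra.TensorProduct.tmul_mul_tmul, one_mul, this, this, Matrix.mulVec_smul,
      b.leftMatrix_mulVec]

/-- A common positive eigenvector of all left multiplications.  Right multiplications commute with
left multiplications, so the Perron vector of a positive right multiplication is one. -/
theorem Module.Basis.exists_common_eigenvector [Nonempty I]
    (hright : ∃ s, ∀ i j, 0 < b.rightMatrix s i j) :
    ∃ (f : S → ℝ) (v : I → ℝ), (∀ i, 0 < v i) ∧ ∀ x, b.leftMatrix x *ᵥ v = f x • v := by
  obtain ⟨s, hs⟩ := hright
  obtain ⟨t, v, hv, hsv⟩ := Matrix.exists_pos_eigenvector hs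
  have : ∀ x, ∃ c : ℝ, b.leftMatrix x *ᵥ v = c • v := fun x => by
    refine Matrix.eq_smul_of_pos_eigenvector hs hv hsv ?_
    rw [Matrix.mulVec_mulVec, ← b.leftMatrix_mul_rightMatrix, ← Matrix.mulVec_mulVec, hsv,
      Matrix.mulVec_smul]
  choose f hf using this
  exact ⟨f, v, hv, hf⟩

section Character

variable {f : S → ℝ} {v : I → ℝ} (hv : ∀ i, 0 < v i) (hf : ∀ x, b.leftMatrix x *ᵥ v = f x • v)
include hv hf

theorem Module.Basis.eigenvalue_unique [Nonempty I] {x : S} {c : ℝ}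
    (h : b.leftMatrix x *ᵥ v = c • v) : f x = c := by
  rw [hf] at h
  obtain ⟨i⟩ := ‹Nonempty I›
  exact mul_right_cancel₀ (hv i).ne' (congrFun h i)

/-- The eigenvalues on a common positive eigenvector form a character. -/
theorem Module.Basis.eigenvalue_mul [Nonempty I] (x y : S) : f (x * y) = f x * f y :=
  b.eigenvalue_unique hv hf (by
    rw [b.leftMatrix_mul, ← Matrix.mulVec_mulVec, hf y, Matrix.mulVec_smul, hf x, smul_smul,
      mul_comm])

theorem Module.Basis.eigenvalue_add [Nonempty I] (x y : S) : f (x + y) = f x + f y :=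
  b.eigenvalue_unique hv hf (by rw [b.leftMatrix_add, Matrix.add_mulVec, hf, hf, add_smul])

theorem Module.Basis.eigenvalue_eq_sum [Nonempty I] (x : S) :
    f x = ∑ i, f (b i) * b.realCoords x i := by
  let g : S →+ ℝ := AddMonoidHom.mk' f (b.eigenvalue_add hv hf)
  refine (b.addMonoidHom_apply g x).trans (Finset.sum_congr rfl fun i _ => ?_)
  rw [nsmul_eq_mul, mul_comm]
  rfl

theorem Module.Basis.eigenvalue_pos (i : I) : 0 < f (b i) := by
  classical
  -- Since `v` dominates a positive multiple `ε` of `1`, the vector `b i * v` dominates `ε * b i`.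
  obtain ⟨ε, hε, hεv⟩ := exists_pos_forall_mul_le hv
    (w := fun i => b.realCoords 1 i + 1) fun i => add_pos_of_nonneg_of_pos (b.realCoords_nonneg _ _)
      one_pos
  have h1 : ε ≤ (b.leftMatrix (b i) *ᵥ v) i := by
    calc ε = ε * (b.leftMatrix (b i) *ᵥ b.realCoords 1) i := by
          rw [b.leftMatrix_mulVec, mul_one, b.realCoords_self, Pi.single_eq_same, mul_one]
      _ = ∑ j, b.leftMatrix (b i) i j * (ε * b.realCoords 1 j) := by
          simp only [Matrix.mulVec, dotProduct, Finset.mul_sum, mul_left_comm]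
      _ ≤ (b.leftMatrix (b i) *ᵥ v) i := Finset.sum_le_sum fun j _ =>
          mul_le_mul_of_nonneg_left (by nlinarith [hεv j]) (b.realCoords_nonneg _ _)
  rw [hf] at h1
  exact pos_of_mul_pos_left (hε.trans_le h1) (hv i).le

theorem Module.Basis.abs_le_eigenvalue {x : S} {c : ℝ} {r : I → ℝ} (hr : r ≠ 0)
    (h : b.leftMatrix x *ᵥ r = c • r) : |c| ≤ f x :=
  Matrix.abs_eigenvalue_le (fun _ _ => b.realCoords_nonneg _ _) hv (hf x) hr h

theorem Module.Basis.eigenvalue_nonneg [Nonempty I] (x : S) : 0 ≤ f x := by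
  obtain ⟨i⟩ := ‹Nonempty I›
  exact (abs_nonneg _).trans
    (b.abs_le_eigenvalue hv hf (fun h => (hv i).ne' (congrFun h i)) (hf x))

/-- Suppose that left multiplication by each `x` has an adjoint left multiplication, with respect
to the inner product in which the basis is orthogonal with norms `D i`.  Then the vector with
coefficients `f (b i) / D i` is a common eigenvector of all left multiplications, with the same
eigenvalues: it is one with the eigenvalue `f x'` for the adjoint `x'` of `x`, and as its
coefficients are positive, its eigenvalue is the spectral radius. -/
theorem Module.Basis.leftMatrix_mulVec_div [Nonempty I] {D : I → ℝ}
    (hD : ∀ i, 0 < D i)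
    (hadj : ∀ x, ∃ x', ∀ i j, b.leftMatrix x i j * D i = b.leftMatrix x' j i * D j) (x : S) :
    b.leftMatrix x *ᵥ (fun i => f (b i) / D i) = f x • (fun i => f (b i) / D i) := by
  set r : I → ℝ := fun i => f (b i) / D i with hrdef
  have hr : ∀ i, 0 < r i := fun i => div_pos (b.eigenvalue_pos hv hf i) (hD i)
  have hex : ∀ x, ∃ c : ℝ, b.leftMatrix x *ᵥ r = c • r := by
    intro x
    obtain ⟨x', hx'⟩ := hadj x
    refine ⟨f x', funext fun i => ?_⟩
    calc (b.leftMatrix x *ᵥ r) i = ∑ j, f (b j) * b.leftMatrix x' j i / D i :=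
          Finset.sum_congr rfl fun j _ => by
            have h1 := hx' i j
            have h2 := (hD i).ne'
            have h3 := (hD j).ne'
            change b.leftMatrix x i j * (f (b j) / D j) = _
            field_simp
            linear_combination f (b j) * h1
      _ = f (x' * b i) / D i := by
          rw [← Finset.sum_div, b.eigenvalue_eq_sum hv hf (x' * b i)]
          rfl
      _ = f x' * r i := by rw [b.eigenvalue_mul hv hf, hrdef, mul_div_assoc]
  choose g hg using hex
  obtain ⟨i⟩ := ‹Nonempty I›
  have hfg : f x = g x := le_antisymm
    ((le_abs_self _).trans
      (b.abs_le_eigenvalue hr hg (fun h => (hv i).ne' (congrFun h i)) (hf x)))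
    ((le_abs_self _).trans
      (b.abs_le_eigenvalue hv hf (fun h => (hr i).ne' (congrFun h i)) (hg x)))
  rw [hfg, hg]

end Character

end BasedSemiring

/-! ### Modules over separable algebras and separable categories -/

/-- The analogue of Maschke's theorem for separable algebras: a `K`-linear retraction is made
`A`-linear by averaging it with the separability idempotent. -/
theorem IsSeparableAlgebra.exists_retraction {K A M N : Type*} [Field K] [Ring A] [Algebra K A]
    (h : IsSeparableAlgebra K A) [AddCommGroup M] [AddCommGroup N] [Module A M] [Module A N]
    (i : N →ₗ[A] M) (hi : Function.Injective i) : ∃ p : M →ₗ[A] N, ∀ n, p (i n) = n := by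
  obtain ⟨θ, hl, hr, hθ⟩ := h
  let _ : Module K M := Module.restrictScalars K A M
  let _ : Module K N := Module.restrictScalars K A N
  have : IsScalarTower K A M := IsScalarTower.restrictScalars K A M
  have : IsScalarTower K A N := IsScalarTower.restrictScalars K A N
  obtain ⟨q, hq⟩ := LinearMap.exists_leftInverse_of_injective (i.restrictScalars K)
    (LinearMap.ker_eq_bot.2 hi)
  have hq' : ∀ n, q (i n) = n := fun n => LinearMap.congr_fun hq n
  let T : A ⊗[K] A →ₗ[K] (M →ₗ[K] N) := TensorProduct.lift
    (LinearMap.mk₂ K (fun a b => Algebra.lsmul K K N a ∘ₗ q ∘ₗ Algebra.lsmul K K M b)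
      (fun a b c => by ext; simp) (fun a b c => by ext; simp)
      (fun a b c => by ext; simp) (fun a b c => by ext; simpa using smul_comm _ _ _))
  have hT : ∀ a b m, T (a ⊗ₜ b) m = a • q (b • m) := fun a b m => rfl
  have hTl : ∀ a t m, T ((a ⊗ₜ[K] (1 : A)) * t) m = a • T t m := by
    intro a t m
    induction t with
    | zero => simp
    | add x y hx hy => rw [mul_add, map_add, map_add, LinearMap.add_apply, LinearMap.add_apply,
        hx, hy, smul_add]
    | tmul x y => rw [Algebra.TensorProduct.tmul_mul_tmul, hT, hT, one_mul, mul_smul]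
  have hTr : ∀ a t m, T (t * ((1 : A) ⊗ₜ[K] a)) m = T t (a • m) := by
    intro a t m
    induction t with
    | zero => simp
    | add x y hx hy => rw [add_mul, map_add, map_add, LinearMap.add_apply, LinearMap.add_apply,
        hx, hy]
    | tmul x y => rw [Algebra.TensorProduct.tmul_mul_tmul, hT, hT, mul_one, mul_smul]
  have hTi : ∀ t n, T t (i n) = LinearMap.mul' K A t • n := by
    intro t n
    induction t with
    | zero => simp
    | add x y hx hy => rw [map_add, map_add, LinearMap.add_apply, hx, hy, add_smul]
    | tmul x y => rw [hT, ← i.map_smul, hq', LinearMap.mul'_apply, mul_smul]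
  refine ⟨{ toFun := T (θ 1), map_add' := map_add _, map_smul' := fun a m => ?_ }, fun n => ?_⟩
  · rw [← hTr, ← hr, one_mul, ← mul_one a, hl, hTl, mul_one, RingHom.id_apply]
  · change T (θ 1) (i n) = n
    rw [hTi, hθ, one_smul]

namespace FGModuleCat

variable {A : Type w} [Ring A] {M N : FGModuleCat.{w} A}

/-- The morphism from the regular module corresponding to an element of a module. -/
def homOfElement (x : M.carrier) : FGModuleCat.of A A ⟶ M :=
  FGModuleCat.ofHom (LinearMap.toSpanSingleton A M.carrier x)

theorem homOfElement_comp (x : M.carrier) (f : M ⟶ N) :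
    homOfElement x ≫ f = homOfElement (f.hom.hom x) :=
  FGModuleCat.hom_ext (LinearMap.comp_toSpanSingleton f.hom.hom x)

theorem homOfElement_eq_zero_iff {x : M.carrier} : homOfElement x = 0 ↔ x = 0 := by
  refine ⟨fun h => ?_, ?_⟩
  · have h1 : (homOfElement x).hom.hom (1 : A) = 0 := by rw [h]; rfl
    exact (one_smul A x).symm.trans h1
  · rintro rfl
    exact FGModuleCat.hom_ext (LinearMap.toSpanSingleton_zero A M.carrier)

theorem injective_of_mono (f : M ⟶ N) [Mono f] : Function.Injective f.hom.hom := by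
  rw [injective_iff_map_eq_zero]
  intro x hx
  rw [← homOfElement_eq_zero_iff, ← cancel_mono f, zero_comp, homOfElement_comp,
    homOfElement_eq_zero_iff, hx]

end FGModuleCat

namespace IsSeparableCategory

variable {K : Type w} [Field K] {C : Type u} [Category.{v} C] [Preadditive C] [Linear K C]

section

attribute [local instance] ModuleCat.moduleOfAlgebraModule ModuleCat.linearOverField

theorem finite_hom (h : IsSeparableCategory K C) (X Y : C) : Module.Finite K (X ⟶ Y) := by
  obtain ⟨A, _, _, F, hA, -, hF, _, _⟩ := h
  have (Z : C) : IsScalarTower K A (F.obj Z).carrier :=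
    ModuleCat.isScalarTower_of_algebra_moduleCat _
  have (Z : C) : Module.Finite K (F.obj Z).carrier := Module.Finite.trans A _
  let G : (X ⟶ Y) →ₗ[K] ((F.obj X).carrier →ₗ[K] (F.obj Y).carrier) :=
    { toFun f := (F.map f).hom.hom.restrictScalars K
      map_add' f g := by rw [F.map_add]; rfl
      map_smul' r f := by rw [F.map_smul]; rfl }
  have hG : Function.Injective G := fun f g hfg => F.map_injective
    (FGModuleCat.hom_ext (LinearMap.restrictScalars_injective K hfg))
  exact Module.Finite.of_injective G hG

end

/-- There is a generator, corresponding to the regular module. -/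
theorem exists_generator (h : IsSeparableCategory K C) :
    ∃ P : C, ∀ {X Y : C} (f : X ⟶ Y), (∀ g : P ⟶ X, g ≫ f = 0) → f = 0 := by
  obtain ⟨A, _, _, F, hA, -, hF, _, -⟩ := h
  refine ⟨F.objPreimage (FGModuleCat.of A A), fun {X Y} f hf => F.map_injective ?_⟩
  rw [F.map_zero]
  refine FGModuleCat.hom_ext (LinearMap.ext fun x => FGModuleCat.homOfElement_eq_zero_iff.1 ?_)
  rw [← FGModuleCat.homOfElement_comp]
  have h1 := congrArg F.map (hf (F.preimage
    ((F.objObjPreimageIso (FGModuleCat.of A A)).hom ≫ FGModuleCat.homOfElement x)))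
  rwa [F.map_comp, F.map_preimage, F.map_zero, Category.assoc,
    Preadditive.IsIso.comp_left_eq_zero] at h1

theorem isSplitMono (h : IsSeparableCategory K C) {X Y : C} (f : X ⟶ Y) [Mono f] :
    IsSplitMono f := by
  obtain ⟨A, _, _, F, -, hsep, hF, -, -⟩ := h
  obtain ⟨p, hp⟩ := hsep.exists_retraction _ (FGModuleCat.injective_of_mono (F.map f))
  exact ⟨⟨F.preimage (FGModuleCat.ofHom p), F.map_injective (by
    rw [F.map_comp, F.map_preimage, F.map_id]
    exact FGModuleCat.hom_ext (LinearMap.ext hp))⟩⟩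

end IsSeparableCategory

/-! ### Semirings with an adjoint form -/

section AdjointForm

open Matrix Module

variable {S : Type*} [Semiring S] {I : Type*} [Fintype I] {b : Basis I ℕ S} {h : S →+ S →+ ℕ}

theorem Module.Basis.repr_eq_zero_of_repr_sum_eq_zero {g : S →+ S} {i : I}
    (hg : b.repr (g (∑ k, b k)) i = 0) (x : S) : b.repr (g x) i = 0 := by
  rw [map_sum, map_sum, Finsupp.finsetSum_apply, Finset.sum_eq_zero_iff] at hg
  rw [b.addMonoidHom_apply g, map_sum, Finsupp.finsetSum_apply]
  refine Finset.sum_eq_zero fun k hk => ?_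
  rw [map_nsmul, Finsupp.smul_apply, hg k hk, smul_zero]

section

variable (horth : ∀ i j, i ≠ j → h (b i) (b j) = 0)
include horth

theorem Module.Basis.form_apply_right (x : S) (i : I) :
    h x (b i) = b.repr x i * h (b i) (b i) := by
  rw [← AddMonoidHom.flip_apply, b.addMonoidHom_apply (h.flip (b i)),
    Finset.sum_eq_single i (fun j _ hj => ?_) (fun hi => absurd (Finset.mem_univ i) hi)]
  · rfl
  · rw [AddMonoidHom.flip_apply, horth j i hj, smul_zero]

theorem Module.Basis.form_apply_left (x : S) (i : I) :
    h (b i) x = b.repr x i * h (b i) (b i) := by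
  rw [b.addMonoidHom_apply (h (b i)),
    Finset.sum_eq_single i (fun j _ hj => ?_) (fun hi => absurd (Finset.mem_univ i) hi)]
  · rfl
  · rw [horth i j hj.symm, smul_zero]

variable (hpos : ∀ i, h (b i) (b i) ≠ 0)
include hpos

theorem Module.Basis.form_self_ne_zero {x : S} (hx : x ≠ 0) : h x x ≠ 0 := by
  obtain ⟨i, hi⟩ : ∃ i, b.repr x i ≠ 0 := by
    by_contra! h0
    exact hx (b.repr.map_eq_zero_iff.1 (Finsupp.ext h0))
  intro h0
  rw [← AddMonoidHom.flip_apply, b.addMonoidHom_apply (h.flip x), Finset.sum_eq_zero_iff] at h0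
  have h1 := h0 i (Finset.mem_univ i)
  rw [AddMonoidHom.flip_apply, b.form_apply_left horth] at h1
  exact mul_ne_zero hi (mul_ne_zero hi (hpos i)) h1

/-- If `1` occurs in `x`, then `y` occurs in `x * y` and in `y * x`. -/
theorem Module.Basis.form_mul_ne_zero (hone : ∃ i, b i = 1) {x y : S} (hx : h x 1 ≠ 0)
    (hy : y ≠ 0) : h (x * y) y ≠ 0 ∧ h (y * x) y ≠ 0 := by
  obtain ⟨i, hi⟩ := hone
  have hxi : b.repr x i ≠ 0 := by
    rw [← hi, b.form_apply_right horth] at hx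
    exact left_ne_zero_of_mul hx
  have key : ∀ g : S →+ S, g (b i) = y → h (g x) y ≠ 0 := by
    intro g hg h0
    rw [← AddMonoidHom.flip_apply, ← AddMonoidHom.comp_apply, b.addMonoidHom_apply,
      Finset.sum_eq_zero_iff] at h0
    have h1 := h0 i (Finset.mem_univ i)
    rw [AddMonoidHom.comp_apply, AddMonoidHom.flip_apply, hg] at h1
    exact mul_ne_zero hxi (b.form_self_ne_zero horth hpos hy) h1
  exact ⟨key (AddMonoidHom.mulRight y) (by simp [hi]), key (AddMonoidHom.mulLeft y) (by simp [hi])⟩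

/-- Every basis element occurs in a right multiple of every other one: if `x'` is the adjoint of
`x`, then `1` occurs in `x * x'`, and therefore `y` occurs in `x * (x' * y)`. -/
theorem Module.Basis.exists_rightMatrix_pos (hone : ∃ i, b i = 1)
    (hadj : ∀ x, ∃ x', ∀ y z, h (x * y) z = h y (x' * z)) :
    ∃ s, ∀ i j, 0 < b.rightMatrix s i j := by
  refine ⟨∑ k, b k, fun i j => Nat.cast_pos.2 (Nat.pos_of_ne_zero fun h0 => ?_)⟩
  obtain ⟨x', hx'⟩ := hadj (b j)
  have hx0 : x' ≠ 0 := fun h0 => by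
    have := hx' 1 (b j)
    rw [mul_one, h0, zero_mul, map_zero] at this
    exact hpos j this
  have h1 : h (b j * x') 1 ≠ 0 := by
    rw [hx', mul_one]
    exact b.form_self_ne_zero horth hpos hx0
  have h2 := (b.form_mul_ne_zero horth hpos hone h1 (b.ne_zero i)).1
  rw [mul_assoc] at h2
  rw [b.form_apply_right horth] at h2
  exact left_ne_zero_of_mul h2
    (b.repr_eq_zero_of_repr_sum_eq_zero (g := AddMonoidHom.mulLeft (b j)) h0 _)

/-- The mirror image of `Module.Basis.exists_rightMatrix_pos`. -/
theorem Module.Basis.exists_leftMatrix_pos (hone : ∃ i, b i = 1)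
    (hadj : ∀ x, ∃ x', ∀ y z, h (y * x) z = h y (z * x')) :
    ∃ s, ∀ i j, 0 < b.leftMatrix s i j := by
  refine ⟨∑ k, b k, fun i j => Nat.cast_pos.2 (Nat.pos_of_ne_zero fun h0 => ?_)⟩
  obtain ⟨x', hx'⟩ := hadj (b j)
  have hx0 : x' ≠ 0 := fun h0 => by
    have := hx' 1 (b j)
    rw [one_mul, h0, mul_zero, map_zero] at this
    exact hpos j this
  have h1 : h (x' * b j) 1 ≠ 0 := by
    rw [hx', one_mul]
    exact b.form_self_ne_zero horth hpos hx0
  have h2 := (b.form_mul_ne_zero horth hpos hone h1 (b.ne_zero i)).2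
  rw [← mul_assoc, b.form_apply_right horth] at h2
  exact left_ne_zero_of_mul h2
    (b.repr_eq_zero_of_repr_sum_eq_zero (g := AddMonoidHom.mulRight (b j)) h0 _)

end

/-- A semiring with a finite basis over `ℕ`, which contains `1` and is orthogonal for a form
such that left and right multiplications have adjoints, has a character `f` whose values are the
largest nonnegative eigenvalues of the left multiplications; the common eigenvectors with these
eigenvalues are the multiples of the vector with coefficients `f (b i) / h (b i) (b i)`. -/
theorem Module.Basis.exists_regular_element
    (horth : ∀ i j, i ≠ j → h (b i) (b j) = 0) (hpos : ∀ i, h (b i) (b i) ≠ 0)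
    (hone : ∃ i, b i = 1)
    (hleft : ∀ x, ∃ x', ∀ y z, h (x * y) z = h y (x' * z))
    (hright : ∀ x, ∃ x', ∀ y z, h (y * x) z = h y (z * x')) :
    ∃ f : S → ℝ,
      (∀ x, IsGreatest {t : ℝ | 0 ≤ t ∧
        Module.End.HasEigenvalue (LinearMap.mulLeft ℝ ((1 : ℝ) ⊗ₜ[ℕ] x)) t} (f x)) ∧
      (∀ i, 0 < f (b i)) ∧
      ∀ R : ℝ ⊗[ℕ] S, (∀ x, ((1 : ℝ) ⊗ₜ[ℕ] x) * R = f x • R) ↔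
        ∃ c : ℝ, R = c • ∑ i, (f (b i) / (h (b i) (b i) : ℝ)) ⊗ₜ[ℕ] b i := by
  have : Nonempty I := hone.nonempty
  obtain ⟨f, v, hv, hf⟩ :=
    b.exists_common_eigenvector (b.exists_rightMatrix_pos horth hpos hone hleft)
  obtain ⟨s, hs⟩ := b.exists_leftMatrix_pos horth hpos hone hright
  set B := b.baseChange ℝ with hB
  set r : I → ℝ := fun i => f (b i) / h (b i) (b i) with hr
  have hDpos : ∀ i, (0 : ℝ) < h (b i) (b i) := fun i => Nat.cast_pos.2 (Nat.pos_of_ne_zero (hpos i))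
  have hrpos : ∀ i, 0 < r i := fun i => div_pos (b.eigenvalue_pos hv hf i) (hDpos i)
  have hreg : ∀ x, b.leftMatrix x *ᵥ r = f x • r := by
    refine b.leftMatrix_mulVec_div hv hf hDpos fun x => ?_
    obtain ⟨x', hx'⟩ := hleft x
    refine ⟨x', fun i j => ?_⟩
    have := hx' (b j) (b i)
    rw [b.form_apply_right horth (x * b j), b.form_apply_left horth (x' * b i)] at this
    change (b.repr (x * b j) i : ℝ) * _ = (b.repr (x' * b i) j : ℝ) * _
    exact_mod_cast this
  have hiff : ∀ (x : S) (c : ℝ) (R : ℝ ⊗[ℕ] S), ((1 : ℝ) ⊗ₜ[ℕ] x) * R = c • R ↔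
      b.leftMatrix x *ᵥ B.equivFun R = c • B.equivFun R := fun x c R => by
    rw [← b.baseChange_equivFun_mul, ← map_smul, B.equivFun.injective.eq_iff]
  have hsum : B.equivFun (∑ i, r i ⊗ₜ[ℕ] b i) = r := by
    rw [← B.equivFun.eq_symm_apply, B.equivFun_symm_apply]
    refine Finset.sum_congr rfl fun i _ => ?_
    rw [hB, Module.Basis.baseChange_apply, TensorProduct.smul_tmul', smul_eq_mul, mul_one]
  refine ⟨f, fun x => ⟨⟨b.eigenvalue_nonneg hv hf x, ?_⟩, ?_⟩, b.eigenvalue_pos hv hf, fun R => ?_⟩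
  · refine Module.End.hasEigenvalue_of_hasEigenvector (x := B.equivFun.symm v)
      ⟨Module.End.mem_eigenspace_iff.2 ((hiff _ _ _).2 ?_), ?_⟩
    · rw [LinearEquiv.apply_symm_apply, hf]
    · obtain ⟨i⟩ := this
      exact fun h0 => (hv i).ne' (congrFun (B.equivFun.symm.map_eq_zero_iff.1 h0) i)
  · rintro t ⟨-, ht⟩
    obtain ⟨R, hR, hR0⟩ := ht.exists_hasEigenvector
    exact (le_abs_self t).trans (b.abs_le_eigenvalue hv hf (B.equivFun.map_ne_zero_iff.2 hR0)
      ((hiff _ _ _).1 (Module.End.mem_eigenspace_iff.1 hR)))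
  · rw [forall_congr' fun x => hiff x (f x) R]
    have hc : ∀ c : ℝ, R = c • ∑ i, r i ⊗ₜ[ℕ] b i ↔ B.equivFun R = c • r := fun c => by
      rw [← B.equivFun.injective.eq_iff, map_smul, hsum]
    rw [exists_congr hc]
    constructor
    · intro hR
      exact Matrix.eq_smul_of_pos_eigenvector hs hrpos (hreg s) (hR s)
    · rintro ⟨c, hcR⟩ x
      rw [hcR, Matrix.mulVec_smul, hreg, smul_comm]

end AdjointForm

/-! ### Dimensions of spaces of morphisms -/

section HomDimension

open Module

variable (K : Type w) [Field K] {C : Type u} [Category.{v} C] [Abelian C] [Linear K C]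

theorem CategoryTheory.finrank_hom_congr {X X' Y Y' : C} (i : X ≅ X') (j : Y ≅ Y') :
    finrank K (X ⟶ Y) = finrank K (X' ⟶ Y') :=
  LinearEquiv.finrank_eq
    { toFun f := i.inv ≫ f ≫ j.hom
      invFun f := i.hom ≫ f ≫ j.inv
      map_add' f g := by simp
      map_smul' r f := by simp
      left_inv f := by simp
      right_inv f := by simp }

variable (hfin : ∀ X Y : C, Module.Finite K (X ⟶ Y))
include hfin

theorem CategoryTheory.finrank_biprod_hom (X Y Z : C) :
    finrank K (X ⊞ Y ⟶ Z) = finrank K (X ⟶ Z) + finrank K (Y ⟶ Z) := by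
  rw [← finrank_prod]
  exact LinearEquiv.finrank_eq
    { toFun f := (biprod.inl ≫ f, biprod.inr ≫ f)
      invFun f := biprod.desc f.1 f.2
      map_add' f g := by simp
      map_smul' r f := by simp
      left_inv f := by ext <;> simp
      right_inv f := by simp }

theorem CategoryTheory.finrank_hom_biprod (X Y Z : C) :
    finrank K (Z ⟶ X ⊞ Y) = finrank K (Z ⟶ X) + finrank K (Z ⟶ Y) := by
  rw [← finrank_prod]
  exact LinearEquiv.finrank_eq
    { toFun f := (f ≫ biprod.fst, f ≫ biprod.snd)
      invFun f := biprod.lift f.1 f.2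
      map_add' f g := by simp
      map_smul' r f := by simp
      left_inv f := by ext <;> simp
      right_inv f := by simp }

theorem CategoryTheory.finrank_end_pos {X : C} (hX : ¬ IsZero X) : 0 < finrank K (X ⟶ X) := by
  have : Nontrivial (X ⟶ X) := ⟨𝟙 X, 0, fun h => hX ((IsZero.iff_id_eq_zero X).2 h)⟩
  exact finrank_pos

omit hfin in
theorem CategoryTheory.finrank_hom_eq_zero_of_isZero_left {X : C} (hX : IsZero X) (Y : C) :
    finrank K (X ⟶ Y) = 0 := by
  have : Subsingleton (X ⟶ Y) := ⟨hX.eq_of_src⟩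
  exact finrank_zero_of_subsingleton

omit hfin in
theorem CategoryTheory.finrank_hom_eq_zero_of_isZero_right {Y : C} (hY : IsZero Y) (X : C) :
    finrank K (X ⟶ Y) = 0 := by
  have : Subsingleton (X ⟶ Y) := ⟨hY.eq_of_tgt⟩
  exact finrank_zero_of_subsingleton

omit hfin in
theorem CategoryTheory.exists_iso_biprod_of_not_simple
    (hsplit : ∀ {X Y : C} (f : X ⟶ Y) [Mono f], IsSplitMono f) {X : C} (h0 : ¬ IsZero X)
    (h1 : ¬ Simple X) :
    ∃ Y Z : C, ¬ IsZero Y ∧ ¬ IsZero Z ∧ Nonempty (X ≅ Y ⊞ Z) := by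
  obtain ⟨Y, f, hf, hf0, hf1⟩ : ∃ (Y : C) (f : Y ⟶ X), Mono f ∧ f ≠ 0 ∧ ¬ IsIso f := by
    by_contra! hcon
    refine h1 ⟨fun {Y} f _ => ⟨fun _ hf0 => h0 ?_, fun hf0 => hcon Y f inferInstance hf0⟩⟩
    rw [IsZero.iff_id_eq_zero, ← IsIso.inv_hom_id f]
    exact (congrArg (inv f ≫ ·) hf0).trans comp_zero
  have := hsplit f
  let i := biprod.uniqueUpToIso _ _
    (isBilimitBinaryBiconeOfIsSplitMonoOfCokernel (cokernelIsCokernel f))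
  refine ⟨Y, cokernel f, fun hY => hf0 (hY.eq_of_src _ _), fun hZ => hf1 ?_, ⟨i⟩⟩
  have : Epi f := Preadditive.epi_of_cokernel_zero (hZ.eq_of_tgt _ _)
  exact isIso_of_mono_of_epi f

end HomDimension

/-! ### The fusion semiring as a based semiring -/

namespace FusionSemiring

open Module

theorem mk_eq_iff {C : Type u} [Category.{v} C] {X Y : C} :
    mk X = mk Y ↔ Nonempty (X ≅ Y) :=
  Quotient.eq (r := isIsomorphicSetoid C)

variable (K : Type w) [Field K] {C : Type u} [Category.{v} C] [Abelian C] [Linear K C]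
  [MonoidalCategory C] [MonoidalPreadditive C]

/-- The proof is by induction on `dim_K End X`: if all monomorphisms split, an object that is neither
zero nor simple is a sum of two objects with endomorphism rings of smaller dimension. -/
theorem mk_mem_closure_simples (hfin : ∀ X Y : C, Module.Finite K (X ⟶ Y))
    (hsplit : ∀ {X Y : C} (f : X ⟶ Y) [Mono f], IsSplitMono f) (X : C) :
    mk X ∈ AddSubmonoid.closure (simples C) := by
  induction hn : finrank K (X ⟶ X) using Nat.strong_induction_on generalizing X with | _ n ih
  by_cases h0 : IsZero X
  · rw [mk_eq_zero h0]
    exact zero_mem _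
  by_cases h1 : Simple X
  · exact AddSubmonoid.subset_closure ⟨X, h1, rfl⟩
  obtain ⟨Y, Z, hY, hZ, ⟨i⟩⟩ := exists_iso_biprod_of_not_simple hsplit h0 h1
  have hY' := finrank_end_pos K hfin hY
  have hZ' := finrank_end_pos K hfin hZ
  rw [finrank_hom_congr K i i, finrank_biprod_hom K hfin, finrank_hom_biprod K hfin,
    finrank_hom_biprod K hfin] at hn
  rw [mk_eq i]
  exact add_mem (ih _ (by omega) Y rfl) (ih _ (by omega) Z rfl)

/-- Each simple object receives a nonzero morphism from the generator `P`, hence is a summand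
of `P`. -/
theorem finite_simples (hclosure : ∀ X : C, mk X ∈ AddSubmonoid.closure (simples C))
    {P : C} (hP : ∀ {X Y : C} (f : X ⟶ Y), (∀ g : P ⟶ X, g ≫ f = 0) → f = 0) :
    (simples C).Finite := by
  have key : ∀ x ∈ AddSubmonoid.closure (simples C), ∃ s : Set (FusionSemiring C), s.Finite ∧
      ∀ X Y : C, mk X = x → Simple Y → ∀ g : X ⟶ Y, g ≠ 0 → mk Y ∈ s := by
    intro x hx
    induction hx using AddSubmonoid.closure_induction with
    | mem x hx =>
      obtain ⟨Z, hZ, rfl⟩ := hx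
      refine ⟨{mk Z}, Set.finite_singleton _, fun X Y hX hY g hg => ?_⟩
      obtain ⟨i⟩ := mk_eq_iff.1 hX
      have : Simple X := Simple.of_iso i
      have := isIso_of_hom_simple hg
      exact (mk_eq (asIso g)).symm.trans hX
    | zero =>
      refine ⟨∅, Set.finite_empty, fun X Y hX hY g hg => hg ?_⟩
      obtain ⟨i⟩ := mk_eq_iff.1 (hX.trans (mk_eq_zero (isZero_zero C)).symm)
      exact (((isZero_zero C).of_iso i).eq_of_src _ _)
    | add x y _ _ hx hy =>
      obtain ⟨s, hs, hxs⟩ := hx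
      obtain ⟨t, ht, hyt⟩ := hy
      refine ⟨s ∪ t, hs.union ht, fun X Y hX hY g hg => ?_⟩
      induction x using ind with | h Z
      induction y using ind with | h W
      obtain ⟨i⟩ := mk_eq_iff.1 (hX : mk X = mk (Z ⊞ W))
      by_contra hcon
      rw [Set.mem_union, not_or] at hcon
      refine hg ((cancel_epi i.inv).1 ?_)
      rw [comp_zero]
      ext
      · rw [comp_zero]
        by_contra h0
        exact hcon.1 (hxs Z Y rfl hY _ h0)
      · rw [comp_zero]
        by_contra h0
        exact hcon.2 (hyt W Y rfl hY _ h0)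
  obtain ⟨s, hs, hPs⟩ := key _ (hclosure P)
  refine hs.subset ?_
  rintro _ ⟨Y, hY, rfl⟩
  obtain ⟨g, hg⟩ : ∃ g : P ⟶ Y, g ≠ 0 := by
    by_contra! hcon
    exact id_nonzero Y (hP (𝟙 Y) fun g => by rw [hcon g, zero_comp])
  exact hPs P Y rfl hY g hg

/-- The form `⟨[X], [Y]⟩ = dim_K Hom(X, Y)` on the fusion semiring. -/
noncomputable def homForm (hfin : ∀ X Y : C, Module.Finite K (X ⟶ Y)) :
    FusionSemiring C →+ FusionSemiring C →+ ℕ where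
  toFun := Quotient.lift (s := isIsomorphicSetoid C) (fun X =>
    { toFun := Quotient.lift (s := isIsomorphicSetoid C) (fun Y => finrank K (X ⟶ Y))
        fun _ _ ⟨i⟩ => finrank_hom_congr K (Iso.refl X) i
      map_zero' := finrank_hom_eq_zero_of_isZero_right K (isZero_zero C) X
      map_add' y z := by
        induction y using ind with | h Y
        induction z using ind with | h Z
        exact finrank_hom_biprod K hfin Y Z X })
    fun X X' ⟨i⟩ => by
      ext y
      induction y using ind with | h Y
      exact finrank_hom_congr K i (Iso.refl Y)
  map_zero' := by
    ext y
    induction y using ind with | h Y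
    exact finrank_hom_eq_zero_of_isZero_left K (isZero_zero C) Y
  map_add' x y := by
    ext z
    induction x using ind with | h X
    induction y using ind with | h Y
    induction z using ind with | h Z
    exact finrank_biprod_hom K hfin X Y Z

variable (hfin : ∀ X Y : C, Module.Finite K (X ⟶ Y))

theorem homForm_self_ne_zero {x : FusionSemiring C} (hx : x ∈ simples C) :
    homForm K hfin x x ≠ 0 := by
  obtain ⟨X, hX, rfl⟩ := hx
  exact (finrank_end_pos K hfin (Simple.not_isZero X)).ne'

theorem homForm_eq_zero {x y : FusionSemiring C} (hx : x ∈ simples C) (hy : y ∈ simples C)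
    (hxy : x ≠ y) : homForm K hfin x y = 0 := by
  obtain ⟨X, hX, rfl⟩ := hx
  obtain ⟨Y, hY, rfl⟩ := hy
  exact finrank_hom_simple_simple_eq_zero_of_not_iso K fun i => hxy (mk_eq i)

include hfin in
/-- The isomorphism classes of simple objects form a basis of the fusion semiring over `ℕ`. -/
theorem exists_basis (hclosure : ∀ X : C, mk X ∈ AddSubmonoid.closure (simples C)) :
    ∃ b : Basis (simples C) ℕ (FusionSemiring C), ∀ i, b i = i := by
  refine ⟨Basis.mk (v := Subtype.val) ?_ ?_, fun i => Basis.mk_apply _ _ i⟩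
  · intro p q hpq
    ext k
    -- The multiplicity of `k` is determined by the pairing with `k`.
    have key : ∀ p : simples C →₀ ℕ,
        homForm K hfin (Finsupp.linearCombination ℕ Subtype.val p) k.1 =
          p k * homForm K hfin k.1 k.1 := by
      intro p
      rw [Finsupp.linearCombination_apply, ← AddMonoidHom.flip_apply, map_finsuppSum,
        Finsupp.sum_eq_single k]
      · rw [map_nsmul]; rfl
      · intro j _ hj
        rw [map_nsmul, AddMonoidHom.flip_apply,
          homForm_eq_zero K hfin j.2 k.2 (fun h => hj (Subtype.ext h)), smul_zero]
      · simp
    have h1 := key p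
    rw [hpq, key q] at h1
    exact (mul_right_cancel₀ (homForm_self_ne_zero K hfin k.2) h1).symm
  · rintro x -
    induction x using ind with | h X
    rw [Subtype.range_coe]
    exact Submodule.closure_subset_span (hclosure X)

variable [MonoidalLinear K C] [RigidCategory C]

/-- `Hom(X ⊗ Y, Z) ≅ Hom(Y, ᘁX ⊗ Z)`. -/
theorem exists_left_adjoint (x : FusionSemiring C) :
    ∃ x', ∀ y z, homForm K hfin (x * y) z = homForm K hfin y (x' * z) := by
  induction x using ind with | h X
  refine ⟨mk (ᘁX), fun y z => ?_⟩
  induction y using ind with | h Y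
  induction z using ind with | h Z
  exact LinearEquiv.finrank_eq
    { tensorLeftHomEquiv Y (ᘁX) X Z with
      map_add' f g := by simp [tensorLeftHomEquiv, MonoidalPreadditive.whiskerLeft_add]
      map_smul' r f := by simp [tensorLeftHomEquiv] }

/-- `Hom(Y ⊗ X, Z) ≅ Hom(Y, Z ⊗ Xᘁ)`. -/
theorem exists_right_adjoint (x : FusionSemiring C) :
    ∃ x', ∀ y z, homForm K hfin (y * x) z = homForm K hfin y (z * x') := by
  induction x using ind with | h X
  refine ⟨mk (Xᘁ), fun y z => ?_⟩
  induction y using ind with | h Y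
  induction z using ind with | h Z
  exact LinearEquiv.finrank_eq
    { tensorRightHomEquiv Y X (Xᘁ) Z with
      map_add' f g := by simp [tensorRightHomEquiv, MonoidalPreadditive.add_whiskerRight]
      map_smul' r f := by simp [tensorRightHomEquiv] }

omit [RigidCategory C] in
/-- `K` acts on `End X` through its image in `End 𝟙` under the left embedding, so that
dimensions over `K` and over `End 𝟙` differ by the constant factor `dim_K End 𝟙`. -/
theorem homForm_self_eq [Simple (𝟙_ C)] (x : FusionSemiring C) :
    homForm K hfin x x = finrank K (𝟙_ C ⟶ 𝟙_ C) * dimEnd x := by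
  induction x using ind with | h X
  let _ : Module (End (𝟙_ C)) (End X) := Module.compHom (End X) (leftEmbedding X)
  have : IsScalarTower K (End (𝟙_ C)) (End X) := ⟨fun r e f => by
    change (f ≫ (λ_ X).inv ≫ ((r • e : 𝟙_ C ⟶ 𝟙_ C) ▷ X) ≫ (λ_ X).hom : X ⟶ X) =
      r • (f ≫ (λ_ X).inv ≫ ((e : 𝟙_ C ⟶ 𝟙_ C) ▷ X) ≫ (λ_ X).hom)
    rw [MonoidalLinear.smul_whiskerRight, Linear.smul_comp, Linear.comp_smul, Linear.comp_smul]⟩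
  exact (finrank_mul_finrank K (End (𝟙_ C)) (End X)).symm

end FusionSemiring

/-! ### The regular element -/

open FusionSemiring in
theorem mainTheorem1 (K : Type w) [Field K] (C : Type u) [Category.{v} C] [Abelian C]
    [Linear K C] [MonoidalCategory C] [MonoidalPreadditive C] [MonoidalLinear K C]
    [RigidCategory C] [IsFusionCategory K C] :
    (simples C).Finite ∧
    (∀ a : FusionSemiring C, IsGreatest (nonnegEigenvalues a) (FPdim a)) ∧
    ∃ R₀ : ℝ ⊗[ℕ] FusionSemiring C,
      R₀ = ∑ᶠ x ∈ simples C, (FPdim x / (dimEnd x : ℝ)) ⊗ₜ[ℕ] x ∧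
      (∀ R : ℝ ⊗[ℕ] FusionSemiring C, IsRegularElement R ↔ ∃ c : ℝ, c ≠ 0 ∧ R = c • R₀) ∧
      (∀ R : ℝ ⊗[ℕ] FusionSemiring C,
        IsRegularElement R ∧ HasPositiveCoefficients R ↔ ∃ c : ℝ, 0 < c ∧ R = c • R₀) := by
  have hsep : IsSeparableCategory K C := IsFusionCategory.separable
  have hunit : Simple (𝟙_ C) := IsFusionCategory.simple_unit K
  have hfin := hsep.finite_hom
  have hclosure := mk_mem_closure_simples K hfin fun f _ => hsep.isSplitMono f
  obtain ⟨P, hP⟩ := hsep.exists_generator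
  have hfinite : (simples C).Finite := finite_simples hclosure hP
  have : Fintype (simples C) := hfinite.fintype
  obtain ⟨b, hb⟩ := exists_basis K hfin hclosure
  have hpos : ∀ i, homForm K hfin (b i) (b i) ≠ 0 := fun i => by
    rw [hb]
    exact homForm_self_ne_zero K hfin i.2
  obtain ⟨f, hf, hfpos, hreg⟩ := b.exists_regular_element (h := homForm K hfin)
    (fun i j hij => by
      rw [hb, hb]
      exact homForm_eq_zero K hfin i.2 j.2 fun h => hij (Subtype.ext h))
    hpos ⟨⟨1, 𝟙_ C, hunit, rfl⟩, hb _⟩ (exists_left_adjoint K hfin) (exists_right_adjoint K hfin)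
  have hFP : ∀ x, FPdim x = f x := fun x => (hf x).csSup_eq
  set e : ℝ := ((Module.finrank K (𝟙_ C ⟶ 𝟙_ C) : ℕ) : ℝ) with he
  have hD : ∀ i, (homForm K hfin (b i) (b i) : ℝ) = e * dimEnd i.1 := fun i => by
    rw [hb, homForm_self_eq K hfin, Nat.cast_mul]
  have hD0 : ∀ i : simples C, e * dimEnd i.1 ≠ 0 := fun i => hD i ▸ Nat.cast_ne_zero.2 (hpos i)
  have i₀ : simples C := ⟨1, 𝟙_ C, hunit, rfl⟩
  have he0 : e ≠ 0 := left_ne_zero_of_mul (hD0 i₀)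
  -- The elements of `ℝ ⊗ S(C)` in coordinates.
  set B := b.baseChange ℝ with hB
  have hsum : ∀ c : FusionSemiring C → ℝ, ∑ᶠ x ∈ simples C, c x ⊗ₜ[ℕ] x = ∑ i, c (i.1) • B i := by
    intro c
    rw [← finsum_set_coe_eq_finsum_mem, finsum_eq_sum_of_fintype]
    refine Finset.sum_congr rfl fun i _ => ?_
    rw [hB, Module.Basis.baseChange_apply, hb, TensorProduct.smul_tmul', smul_eq_mul, mul_one]
  have hrepr : ∀ (c : FusionSemiring C → ℝ) (i : simples C),
      B.repr (∑ᶠ x ∈ simples C, c x ⊗ₜ[ℕ] x) i = c i := fun c i => by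
    rw [hsum, B.repr_sum_self]
  refine ⟨hfinite, fun a => (hFP a).symm ▸ hf a, _, rfl, ?_⟩
  set R₀ := ∑ᶠ x ∈ simples C, (FPdim x / (dimEnd x : ℝ)) ⊗ₜ[ℕ] x with hR₀
  have hcoeff : ∀ i : simples C, 0 < FPdim i.1 / (dimEnd i.1 : ℝ) := fun i =>
    div_pos (by rw [hFP, ← hb]; exact hfpos i)
      (lt_of_le_of_ne (Nat.cast_nonneg _) (right_ne_zero_of_mul (hD0 i)).symm)
  have hR₀0 : R₀ ≠ 0 := fun h => by
    have h1 := hrepr (fun x => FPdim x / (dimEnd x : ℝ)) i₀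
    rw [← hR₀, h, map_zero] at h1
    exact (hcoeff i₀).ne h1
  have hR₀' : R₀ = e • ∑ i, (f (b i) / (homForm K hfin (b i) (b i) : ℝ)) ⊗ₜ[ℕ] b i := by
    rw [hR₀, hsum fun x => FPdim x / (dimEnd x : ℝ), Finset.smul_sum]
    refine Finset.sum_congr rfl fun i _ => ?_
    have h1 := right_ne_zero_of_mul (hD0 i)
    rw [hD, hB, Module.Basis.baseChange_apply, TensorProduct.smul_tmul', TensorProduct.smul_tmul',
      hFP, hb, smul_eq_mul, smul_eq_mul]
    congr 1
    field_simp
  have hregular : ∀ R : ℝ ⊗[ℕ] FusionSemiring C,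
      IsRegularElement R ↔ ∃ c : ℝ, c ≠ 0 ∧ R = c • R₀ := fun R => by
    have hR : (∀ x, ((1 : ℝ) ⊗ₜ[ℕ] x) * R = FPdim x • R) ↔ ∃ c : ℝ, R = c • R₀ := by
      simp only [hFP]
      rw [hreg, hR₀']
      constructor
      · rintro ⟨c, rfl⟩
        exact ⟨c / e, by rw [smul_smul, div_mul_cancel₀ _ he0]⟩
      · rintro ⟨c, rfl⟩
        exact ⟨c * e, by rw [smul_smul]⟩
    constructor
    · rintro ⟨h0, h⟩
      obtain ⟨c, rfl⟩ := hR.1 h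
      exact ⟨c, fun hc => h0 (by rw [hc, zero_smul]), rfl⟩
    · rintro ⟨c, hc, rfl⟩
      refine ⟨fun h => hR₀0 ?_, hR.2 ⟨c, rfl⟩⟩
      rw [← inv_smul_smul₀ hc R₀, h, smul_zero]
  refine ⟨hregular, fun R => ⟨?_, ?_⟩⟩
  · rintro ⟨h, a, ha, haR⟩
    obtain ⟨c, -, rfl⟩ := (hregular R).1 h
    refine ⟨c, ?_, rfl⟩
    have h1 := hrepr a i₀
    rw [← haR, map_smul, Finsupp.smul_apply, smul_eq_mul,
      hrepr fun x => FPdim x / (dimEnd x : ℝ)] at h1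
    exact pos_of_mul_pos_left (h1 ▸ ha _ i₀.2) (hcoeff i₀).le
  · rintro ⟨c, hc, rfl⟩
    refine ⟨(hregular _).2 ⟨c, hc.ne', rfl⟩, fun x => c * (FPdim x / (dimEnd x : ℝ)),
      fun x hx => mul_pos hc (hcoeff ⟨x, hx⟩), ?_⟩
    rw [hR₀, hsum fun x => FPdim x / (dimEnd x : ℝ), hsum, Finset.smul_sum]
    simp only [smul_smul]
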